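/- Let $\theta\in(0,\frac{\pi}{2})$ and let $$\widetilde\Omega_\theta=\Big\{(\tilde x,\tilde y)\in\big(-\tfrac{\pi}{\tan\theta},+\infty\big)\times(0,\pi)\;:\;\tilde y<\tilde x\tan\theta+\pi\ \text{ if }\ \tilde x\in\big(-\tfrac{\pi}{\tan\theta},0\big)\Big\}.$$ Let $\partial_{\mathsf{Dir}}\widetilde\Omega_\theta$ be the union of the horizontal parts of its boundary, $\{\tilde y=0,\ \tilde x\ge-\frac{\pi}{\tan\theta}\}\cup\{\tilde y=\pi,\ \tilde x\ge0\}$, and let $V=\{u\in H^1(\widetilde\Omega_\theta;\mathbb{C}) : u=0 \text{ on } \partial_{\mathsf{Dir}}\widetilde\Omega_\theta\}$, where the boundary condition means that $u$ is a limit in $H^1(\widetilde\Omega_\theta)$ of functions in $C_c^\infty(\mathbb{R}^2\setminus\partial_{\mathsf{Dir}}\widetilde\Omega_\theta)$. Let $\Delta^{\mathsf{Mix}}_{\widetilde\Omega_\theta}$ be the positive Laplacian with Dirichlet conditions on $\partial_{\mathsf{Dir}}\widetilde\Omega_\theta$ and Neumann conditions on the remaining (slanted) side, that is, the self-adjoint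 operator on $L^2(\widetilde\Omega_\theta)$ such that $u$ is in its domain and is mapped to $f\in L^2(\widetilde\Omega_\theta)$ if and only if $u\in V$ and $\int_{\widetilde\Omega_\theta}\nabla u\cdot\overline{\nabla v}=\int_{\widetilde\Omega_\theta} f\,\overline{v}$ for all $v\in V$. Let $\psi$ be an eigenvector of $\Delta^{\mathsf{Mix}}_{\widetilde\Omega_\theta}$ associated with an eigenvalue $\lambda<1$. Then for all $\varepsilon>0$ $$\int_0^\infty\int_0^\pi e^{2\tilde x(\sqrt{1-\lambda}-\varepsilon)}\left(|\psi(\tilde x,\tilde y)|^2+|\nabla\psi(\tilde x,\tilde y)|^2\right)\,d\tilde y\,d\tilde x<\infty .$$ -/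

import Mathlib

open MeasureTheory Set Filter Topology
open scoped ContDiff

/-- Classical partial derivative of `φ` at `p` in the first coordinate. -/
noncomputable def partialX (φ : ℝ × ℝ → ℂ) (p : ℝ × ℝ) : ℂ := fderiv ℝ φ p (1, 0)

/-- Classical partial derivative of `φ` at `p` in the second coordinate. -/
noncomputable def partialY (φ : ℝ × ℝ → ℂ) (p : ℝ × ℝ) : ℂ := fderiv ℝ φ p (0, 1)

/-- `(gx, gy)` is the weak (distributional) gradient of `u` on the open set `Ω`. -/
structure HasWeakGradient (Ω : Set (ℝ × ℝ)) (u gx gy : ℝ × ℝ → ℂ) : Prop where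
  locInt : LocallyIntegrableOn u Ω volume
  locInt_x : LocallyIntegrableOn gx Ω volume
  locInt_y : LocallyIntegrableOn gy Ω volume
  weak_x : ∀ φ : ℝ × ℝ → ℂ, ContDiff ℝ ∞ φ → HasCompactSupport φ → tsupport φ ⊆ Ω →
    ∫ p in Ω, u p * partialX φ p = -∫ p in Ω, gx p * φ p
  weak_y : ∀ φ : ℝ × ℝ → ℂ, ContDiff ℝ ∞ φ → HasCompactSupport φ → tsupport φ ⊆ Ω →
    ∫ p in Ω, u p * partialY φ p = -∫ p in Ω, gy p * φ p

/-- `u` belongs to the Sobolev space `H¹(Ω)`, and `(gx, gy)` is its weak gradient. -/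
structure MemH1 (Ω : Set (ℝ × ℝ)) (u gx gy : ℝ × ℝ → ℂ) : Prop where
  memLp : MemLp u 2 (volume.restrict Ω)
  memLp_x : MemLp gx 2 (volume.restrict Ω)
  memLp_y : MemLp gy 2 (volume.restrict Ω)
  weakGradient : HasWeakGradient Ω u gx gy

/-- `u` belongs to the form domain `V = {u ∈ H¹(Ω) : u = 0 on Γ}`, where `Γ` is a closed part of
the boundary of `Ω`, and `(gx, gy)` is the weak gradient of `u`.  The Dirichlet condition on `Γ` is
understood in the usual way: `u` is the limit in `H¹(Ω)` of smooth functions with compact support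
in `ℝ² ∖ Γ`, that is, of smooth functions with bounded support that vanish near `Γ` (and are not
constrained on the rest of the boundary). -/
structure MemFormDomain (Ω Γ : Set (ℝ × ℝ)) (u gx gy : ℝ × ℝ → ℂ) : Prop where
  memH1 : MemH1 Ω u gx gy
  approx : ∃ φ : ℕ → ℝ × ℝ → ℂ,
    (∀ n, ContDiff ℝ ∞ (φ n) ∧ HasCompactSupport (φ n) ∧ tsupport (φ n) ⊆ Γᶜ) ∧
    Tendsto (fun n => eLpNorm (u - φ n) 2 (volume.restrict Ω)) atTop (𝓝 0) ∧
    Tendsto (fun n => eLpNorm (gx - partialX (φ n)) 2 (volume.restrict Ω)) atTop (𝓝 0) ∧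
    Tendsto (fun n => eLpNorm (gy - partialY (φ n)) 2 (volume.restrict Ω)) atTop (𝓝 0)

/-- The graph of the positive Laplacian on `Ω` with Dirichlet condition on `Γ` and Neumann condition
on the rest of the boundary: the self-adjoint operator `A` on `L²(Ω)` associated with the form
`b(u, v) = ∫_Ω ∇u · conj ∇v` on `V = {u ∈ H¹(Ω) : u = 0 on Γ}`.  The proposition
`IsMixedLaplacian Ω Γ u f` says that `u ∈ Dom A` and `A u = f`, i.e. `u ∈ V`, `f ∈ L²(Ω)` and
`b(u, v) = ⟨f, v⟩` for all `v ∈ V`. -/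
def IsMixedLaplacian (Ω Γ : Set (ℝ × ℝ)) (u f : ℝ × ℝ → ℂ) : Prop :=
  ∃ gx gy : ℝ × ℝ → ℂ, MemFormDomain Ω Γ u gx gy ∧ MemLp f 2 (volume.restrict Ω) ∧
    ∀ v hx hy : ℝ × ℝ → ℂ, MemFormDomain Ω Γ v hx hy →
      ∫ p in Ω, (gx p * star (hx p) + gy p * star (hy p)) = ∫ p in Ω, f p * star (v p)

/-- The half-guide of opening `θ`: the part of the strip `0 < y < π` lying to the right of the
segment that joins `(-π / tan θ, 0)` to `(0, π)`. -/
def halfGuide (θ : ℝ) : Set (ℝ × ℝ) :=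
  {p | -Real.pi / Real.tan θ < p.1 ∧ 0 < p.2 ∧ p.2 < Real.pi ∧
    (p.1 < 0 → p.2 < p.1 * Real.tan θ + Real.pi)}

/-- The Dirichlet part of the boundary of the half-guide, namely its two horizontal half-lines. -/
def halfGuideDirichlet (θ : ℝ) : Set (ℝ × ℝ) :=
  {p | (p.2 = 0 ∧ -Real.pi / Real.tan θ ≤ p.1) ∨ (p.2 = Real.pi ∧ 0 ≤ p.1)}

/-- `ψ` is an eigenvector, for the eigenvalue `lam`, of the positive mixed Laplacian on the
half-guide (Dirichlet on the horizontal parts of the boundary, Neumann on the slanted segment). -/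
def IsMixedEigenvector (θ lam : ℝ) (ψ : ℝ × ℝ → ℂ) : Prop :=
  ¬ ψ =ᵐ[volume.restrict (halfGuide θ)] 0 ∧
    IsMixedLaplacian (halfGuide θ) (halfGuideDirichlet θ) ψ (fun p => (lam : ℂ) * ψ p)

/-!
This is Agmon's method. Testing the weak equation `Δψ = λψ` with `w²ψ`, for a real weight `w`, gives
the IMS identity `∫ |∇(wψ)|² = λ ∫ |wψ|² + ∫ |∇w|² |ψ|²`, so a weight with `|∇w| ≤ a |w|` satisfies
`∫ |∇(wψ)|² ≤ (λ + a²) ∫ |wψ|²`. In the half-strip `x > 0` the Dirichlet condition on both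
horizontal sides and Wirtinger's inequality in `y` bound the energy of `wψ` below by its mass. If
`λ + a² < 1`, the mass of `wψ` in the half-strip is therefore controlled by its mass on the bounded
remainder, where `w ≤ 1` as soon as `w ≤ exp (a x)`. Since `exp (a x)` itself is not an admissible
multiplier, one takes bounded weights increasing to it and concludes by Fatou's lemma.
-/

section Wirtinger

variable {F : Type*} [NormedAddCommGroup F] [InnerProductSpace ℝ F] {f f' : ℝ → F} {a b κ : ℝ}

theorem mul_integral_norm_sq_le_of_riccati {c : ℝ → ℝ} (hab : a ≤ b)
    (hf : ∀ y ∈ uIcc a b, HasDerivAt f (f' y) y) (hf' : ContinuousOn f' (uIcc a b))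
    (ha : f a = 0) (hb : f b = 0) (hc : ∀ y ∈ uIcc a b, HasDerivAt c (κ + c y ^ 2) y) :
    κ * ∫ y in a..b, ‖f y‖ ^ 2 ≤ ∫ y in a..b, ‖f' y‖ ^ 2 := by
  have hfc : ContinuousOn f (uIcc a b) := fun y hy => (hf y hy).continuousAt.continuousWithinAt
  have hcc : ContinuousOn c (uIcc a b) := fun y hy => (hc y hy).continuousAt.continuousWithinAt
  have hderiv : ∀ y ∈ uIcc a b, HasDerivAt (fun y => ‖f y‖ ^ 2 * c y)
      (2 * inner ℝ (f y) (f' y) * c y + ‖f y‖ ^ 2 * (κ + c y ^ 2)) y := fun y hy =>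
    (hf y hy).norm_sq.mul (hc y hy)
  have hderiv_int : IntervalIntegrable
      (fun y => 2 * inner ℝ (f y) (f' y) * c y + ‖f y‖ ^ 2 * (κ + c y ^ 2)) volume a b :=
    ContinuousOn.intervalIntegrable (by fun_prop)
  have hf_int : IntervalIntegrable (fun y => κ * ‖f y‖ ^ 2) volume a b :=
    ContinuousOn.intervalIntegrable (by fun_prop)
  have hf'_int : IntervalIntegrable (fun y => ‖f' y‖ ^ 2) volume a b :=
    ContinuousOn.intervalIntegrable (by fun_prop)
  have hboundary : ∫ y in a..b,
      (2 * inner ℝ (f y) (f' y) * c y + ‖f y‖ ^ 2 * (κ + c y ^ 2)) = 0 := by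
    simpa [ha, hb] using intervalIntegral.integral_eq_sub_of_hasDerivAt hderiv hderiv_int
  -- The two integrands differ by the square `‖f' + c f‖ ^ 2`.
  have hsquare (y : ℝ) : κ * ‖f y‖ ^ 2 ≤
      ‖f' y‖ ^ 2 + (2 * inner ℝ (f y) (f' y) * c y + ‖f y‖ ^ 2 * (κ + c y ^ 2)) := by
    have h := norm_add_sq_real (f' y) (c y • f y)
    rw [inner_smul_right, real_inner_comm, norm_smul, mul_pow, Real.norm_eq_abs, sq_abs] at h
    nlinarith [sq_nonneg ‖f' y + c y • f y‖]
  calc κ * ∫ y in a..b, ‖f y‖ ^ 2 = ∫ y in a..b, κ * ‖f y‖ ^ 2 :=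
        (intervalIntegral.integral_const_mul _ _).symm
    _ ≤ ∫ y in a..b,
        (‖f' y‖ ^ 2 + (2 * inner ℝ (f y) (f' y) * c y + ‖f y‖ ^ 2 * (κ + c y ^ 2))) :=
      intervalIntegral.integral_mono_on hab hf_int (hf'_int.add hderiv_int) fun y _ => hsquare y
    _ = ∫ y in a..b, ‖f' y‖ ^ 2 := by
      rw [intervalIntegral.integral_add hf'_int hderiv_int, hboundary, add_zero]

theorem hasDerivAt_mul_tan_mul_sub {k m y : ℝ} (hy : Real.cos (k * (y - m)) ≠ 0) :
    HasDerivAt (fun y => k * Real.tan (k * (y - m)))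
      (k ^ 2 + (k * Real.tan (k * (y - m))) ^ 2) y := by
  have hinner : HasDerivAt (fun y => k * (y - m)) k y := by
    simpa using ((hasDerivAt_id y).sub_const m).const_mul k
  refine (((Real.hasDerivAt_tan hy).comp y hinner).const_mul k).congr_deriv ?_
  rw [one_div, ← Real.inv_one_add_tan_sq hy, inv_inv]
  ring

theorem sq_pi_div_mul_integral_norm_sq_le (hab : a < b)
    (hf : ∀ y ∈ uIcc a b, HasDerivAt f (f' y) y) (hf' : ContinuousOn f' (uIcc a b))
    (ha : f a = 0) (hb : f b = 0) :
    (Real.pi / (b - a)) ^ 2 * ∫ y in a..b, ‖f y‖ ^ 2 ≤ ∫ y in a..b, ‖f' y‖ ^ 2 := by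
  have hpos : 0 < Real.pi / (b - a) := div_pos Real.pi_pos (sub_pos.2 hab)
  -- At `k = π / (b - a)` the tangent blows up at both ends, so the bound is reached as a limit.
  have hbelow : ∀ k ∈ Ioo 0 (Real.pi / (b - a)),
      k ^ 2 * ∫ y in a..b, ‖f y‖ ^ 2 ≤ ∫ y in a..b, ‖f' y‖ ^ 2 := fun k hk =>
    mul_integral_norm_sq_le_of_riccati hab.le hf hf' ha hb fun y hy => by
      refine hasDerivAt_mul_tan_mul_sub (m := (a + b) / 2) (Real.cos_pos_of_mem_Ioo ?_).ne'
      have hkπ : k * (b - a) < Real.pi := (lt_div_iff₀ (sub_pos.2 hab)).1 hk.2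
      rw [uIcc_of_le hab.le] at hy
      constructor <;> nlinarith [hk.1, hy.1, hy.2]
  have hlim : Tendsto (fun k : ℝ => k ^ 2 * ∫ y in a..b, ‖f y‖ ^ 2) (𝓝[<] (Real.pi / (b - a)))
      (𝓝 ((Real.pi / (b - a)) ^ 2 * ∫ y in a..b, ‖f y‖ ^ 2)) :=
    (Continuous.tendsto (by fun_prop) _).mono_left nhdsWithin_le_nhds
  exact le_of_tendsto hlim (eventually_of_mem (Ioo_mem_nhdsLT hpos) hbelow)

end Wirtinger

section Lebesgue

theorem norm_smul_apply_sq {α E : Type*} [NormedAddCommGroup E] [NormedSpace ℝ E] (g : α → ℝ)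
    (u : α → E) (x : α) : ‖(g • u) x‖ ^ 2 = g x ^ 2 * ‖u x‖ ^ 2 := by
  rw [Pi.smul_apply', norm_smul, mul_pow, Real.norm_eq_abs, sq_abs]

variable {α E : Type*} [MeasurableSpace α] {μ : Measure α} [NormedAddCommGroup E]

theorem tendsto_integral_norm_sq {ι : Type*} {l : Filter ι} {f : ι → α → E} {g : α → E}
    (hf : ∀ i, MemLp (f i) 2 μ) (hg : MemLp g 2 μ)
    (h : Tendsto (fun i => eLpNorm (g - f i) 2 μ) l (𝓝 0)) :
    Tendsto (fun i => ∫ x, ‖f i x‖ ^ 2 ∂μ) l (𝓝 (∫ x, ‖g x‖ ^ 2 ∂μ)) := by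
  have hnorm {v : α → E} (hv : MemLp v 2 μ) : ‖hv.toLp v‖ ^ 2 = ∫ x, ‖v x‖ ^ 2 ∂μ := by
    rw [Lp.norm_toLp, toReal_eLpNorm hv.1,
      lpNorm_eq_integral_norm_rpow_toReal (by simp) (by simp) hv.1]
    simp only [ENNReal.toReal_ofNat, Real.rpow_ofNat]
    exact Real.rpow_inv_natCast_pow (by positivity) two_ne_zero
  simp only [eLpNorm_sub_comm g] at h
  simpa only [hnorm] using ((Lp.tendsto_Lp_iff_tendsto_eLpNorm'' f hf g hg).2 h).norm.pow 2

theorem integrable_of_tendsto_of_integral_norm_le {f : ℕ → α → E} {g : α → E} {C : ℝ}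
    (hf : ∀ n, Integrable (f n) μ) (hC : ∀ n, ∫ x, ‖f n x‖ ∂μ ≤ C)
    (h : ∀ᵐ x ∂μ, Tendsto (fun n => f n x) atTop (𝓝 (g x))) : Integrable g μ := by
  refine memLp_one_iff_integrable.1 ⟨aestronglyMeasurable_of_tendsto_ae atTop (fun n => (hf n).1) h,
    (Lp.eLpNorm_lim_le_liminf_eLpNorm (fun n => (hf n).1) g h).trans_lt
      (lt_of_le_of_lt ?_ (ENNReal.ofReal_lt_top (r := C)))⟩
  refine liminf_le_of_frequently_le' (.of_forall fun n => ?_)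
  rw [eLpNorm_one_eq_lintegral_enorm, ← ofReal_integral_norm_eq_lintegral_enorm (hf n)]
  exact ENNReal.ofReal_le_ofReal (hC n)

variable [NormedSpace ℝ E] {g : α → ℝ} {C : ℝ} {p : ENNReal}

theorem memLp_smul_of_bound {u : α → E} (hg : AEStronglyMeasurable g μ) (hC : ∀ x, ‖g x‖ ≤ C)
    (hu : MemLp u p μ) : MemLp (fun x => g x • u x) p μ :=
  hu.smul (memLp_top_of_bound hg C (.of_forall hC))

theorem tendsto_eLpNorm_smul_of_bound {ι : Type*} {l : Filter ι} {u : ι → α → E}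
    (hC : ∀ x, ‖g x‖ ≤ C) (hu : Tendsto (fun i => eLpNorm (u i) p μ) l (𝓝 0)) :
    Tendsto (fun i => eLpNorm (fun x => g x • u i x) p μ) l (𝓝 0) := by
  have h := ENNReal.Tendsto.const_mul hu (.inr (ENNReal.ofReal_ne_top (r := C)))
  rw [mul_zero] at h
  refine tendsto_of_tendsto_of_tendsto_of_le_of_le tendsto_const_nhds h (fun _ => zero_le)
    fun i => eLpNorm_le_mul_eLpNorm_of_ae_le_mul (.of_forall fun x => ?_) p
  rw [norm_smul]
  exact mul_le_mul_of_nonneg_right (hC x) (norm_nonneg _)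

theorem setIntegral_norm_smul_sq_le {u : α → E} {s t : Set α} (hs : MeasurableSet s) (hst : s ⊆ t)
    (hu : IntegrableOn (fun x => ‖u x‖ ^ 2) t μ) (hC : ∀ x ∈ s, |g x| ≤ C) :
    ∫ x in s, ‖(g • u) x‖ ^ 2 ∂μ ≤ C ^ 2 * ∫ x in t, ‖u x‖ ^ 2 ∂μ := calc
  _ ≤ ∫ x in s, C ^ 2 * ‖u x‖ ^ 2 ∂μ := by
    refine integral_mono_of_nonneg (.of_forall fun x => sq_nonneg _)
      ((hu.mono_set hst).const_mul _) (ae_restrict_of_forall_mem hs fun x hx => ?_)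
    simp only [norm_smul_apply_sq, ← sq_abs (g x)]
    gcongr
    exact hC x hx
  _ = C ^ 2 * ∫ x in s, ‖u x‖ ^ 2 ∂μ := integral_const_mul _ _
  _ ≤ C ^ 2 * ∫ x in t, ‖u x‖ ^ 2 ∂μ :=
    mul_le_mul_of_nonneg_left (setIntegral_mono_set hu (.of_forall fun x => sq_nonneg _)
      hst.eventuallyLE) (sq_nonneg C)

theorem integrable_mul_of_tsupport_subset {X R : Type*} [TopologicalSpace X] [T2Space X]
    [MeasurableSpace X] [OpensMeasurableSpace X] [NormedRing R] [SecondCountableTopologyEither X R]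
    {ν : Measure X} {s : Set X} {f φ : X → R} (hf : LocallyIntegrableOn f s ν)
    (hφ : Continuous φ) (hφc : HasCompactSupport φ) (hφs : tsupport φ ⊆ s) :
    Integrable (fun x => f x * φ x) ν :=
  (integrableOn_iff_integrable_of_support_subset fun _ hx =>
    subset_tsupport φ (right_ne_zero_of_mul hx)).1
    ((hf.integrableOn_compact_subset hφs hφc).mul_continuousOn hφ.continuousOn hφc)

end Lebesgue

section WeakDerivative

variable {E : Type*} [NormedAddCommGroup E] [NormedSpace ℝ E] {v : E} {g : E → ℝ}
  {u u' w w' φ : E → ℂ}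

/-- The derivative in the direction `v` of `g • u` prescribed by the product rule, when `u'` is the
derivative (classical or weak) of `u` in that direction. -/
noncomputable def productDeriv (v : E) (g : E → ℝ) (u u' : E → ℂ) : E → ℂ :=
  fun p => g p • u' p + fderiv ℝ g p v • u p

theorem fderiv_smul_apply_eq_productDeriv (hg : Differentiable ℝ g) (hφ : Differentiable ℝ φ) :
    (fun p => fderiv ℝ (g • φ) p v) = productDeriv v g φ fun p => fderiv ℝ φ p v := by
  ext p
  simp [fderiv_smul (hg p) (hφ p), productDeriv]

theorem productDeriv_sub :
    productDeriv v g (u - w) (u' - w') = productDeriv v g u u' - productDeriv v g w w' := by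
  ext p
  simp only [productDeriv, Pi.sub_apply, smul_sub]
  ring

theorem continuous_fderiv_apply {F : Type*} [NormedAddCommGroup F] [NormedSpace ℝ F] {f : E → F}
    (hf : ContDiff ℝ ∞ f) (v : E) : Continuous fun p => fderiv ℝ f p v :=
  (hf.continuous_fderiv (by simp)).clm_apply continuous_const

variable [MeasurableSpace E] {μ : Measure E} {Ω : Set E}

/-- `u'` is the weak (distributional) derivative of `u` on the open set `Ω` in the direction `v`. -/
structure HasWeakDirDeriv (μ : Measure E) (Ω : Set E) (v : E) (u u' : E → ℂ) : Prop where
  locInt : LocallyIntegrableOn u Ω μ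
  locInt_deriv : LocallyIntegrableOn u' Ω μ
  weak : ∀ φ : E → ℂ, ContDiff ℝ ∞ φ → HasCompactSupport φ → tsupport φ ⊆ Ω →
    ∫ p in Ω, u p * fderiv ℝ φ p v ∂μ = -∫ p in Ω, u' p * φ p ∂μ

variable [BorelSpace E] [FiniteDimensional ℝ E]

theorem HasWeakDirDeriv.smul (hΩ : IsOpen Ω) (hg : ContDiff ℝ ∞ g)
    (h : HasWeakDirDeriv μ Ω v u u') :
    HasWeakDirDeriv μ Ω v (g • u) (productDeriv v g u u') := by
  have locInt_smul {k : E → ℝ} {f : E → ℂ} (hk : Continuous k) (hf : LocallyIntegrableOn f Ω μ) :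
      LocallyIntegrableOn (fun p => k p • f p) Ω μ :=
    hf.continuousOn_smul hΩ.isLocallyClosed hk.continuousOn
  have hgu := locInt_smul hg.continuous h.locInt
  have hgu' := locInt_smul hg.continuous h.locInt_deriv
  have hdu := locInt_smul (continuous_fderiv_apply hg v) h.locInt
  refine ⟨hgu, hgu'.add hdu, fun φ hφ hφc hφΩ => ?_⟩
  have integrable_mul {f : E → ℂ} (hf : LocallyIntegrableOn f Ω μ) :
      IntegrableOn (fun p => f p * φ p) Ω μ :=
    (integrable_mul_of_tsupport_subset hf hφ.continuous hφc hφΩ).integrableOn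
  have integrable_mul_deriv : IntegrableOn (fun p => g p • u p * fderiv ℝ φ p v) Ω μ :=
    (integrable_mul_of_tsupport_subset hgu (continuous_fderiv_apply hφ v)
      (hφc.fderiv_apply ℝ v) ((tsupport_fderiv_apply_subset ℝ v).trans hφΩ)).integrableOn
  have hderiv (p : E) : u p * fderiv ℝ (g • φ) p v =
      g p • u p * fderiv ℝ φ p v + fderiv ℝ g p v • u p * φ p := by
    have := congrFun (fderiv_smul_apply_eq_productDeriv (v := v) (hg.differentiable (by simp))
      (hφ.differentiable (by simp))) p
    simp only [this, productDeriv, Complex.real_smul]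
    ring
  have htest : ∫ p in Ω, u p * fderiv ℝ (g • φ) p v ∂μ = -∫ p in Ω, g p • u' p * φ p ∂μ := by
    simpa only [Pi.smul_apply', mul_smul_comm, smul_mul_assoc] using
      h.weak (g • φ) (hg.smul hφ) hφc.smul_left ((tsupport_smul_subset_right g φ).trans hφΩ)
  simp only [hderiv] at htest
  rw [integral_add integrable_mul_deriv (integrable_mul hdu)] at htest
  simp only [productDeriv, add_mul, Pi.smul_apply']
  rw [integral_add (integrable_mul hgu') (integrable_mul hdu), neg_add, ← htest,
    add_neg_cancel_right]

theorem HasWeakDirDeriv.ae_eq (hΩ : IsOpen Ω) (h : HasWeakDirDeriv μ Ω v u u')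
    (h' : HasWeakDirDeriv μ Ω v u w') : u' =ᵐ[μ.restrict Ω] w' := by
  have hzero : ∀ g : E → ℝ, ContDiff ℝ ∞ g → HasCompactSupport g → tsupport g ⊆ Ω →
      ∫ p, g p • (u' - w') p ∂μ = 0 := fun g hg hgc hgΩ => by
    have hφ : ContDiff ℝ ∞ fun p => (g p : ℂ) := Complex.ofRealCLM.contDiff.comp hg
    have hφc : HasCompactSupport fun p => (g p : ℂ) := hgc.comp_left Complex.ofReal_zero
    have hφΩ : tsupport (fun p => (g p : ℂ)) ⊆ Ω :=
      (tsupport_comp_subset Complex.ofReal_zero g).trans hgΩ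
    have hint {f : E → ℂ} (hf : LocallyIntegrableOn f Ω μ) : Integrable (fun p => f p * g p) μ :=
      integrable_mul_of_tsupport_subset hf hφ.continuous hφc hφΩ
    have hres (f : E → ℂ) : ∫ p in Ω, f p * g p ∂μ = ∫ p, f p * g p ∂μ :=
      setIntegral_eq_integral_of_forall_compl_eq_zero fun p hp => by
        rw [image_eq_zero_of_notMem_tsupport fun h => hp (hgΩ h), Complex.ofReal_zero, mul_zero]
    have heq : ∫ p, u' p * g p ∂μ = ∫ p, w' p * g p ∂μ := by
      rw [← hres, ← hres]
      exact neg_injective ((h.weak _ hφ hφc hφΩ).symm.trans (h'.weak _ hφ hφc hφΩ))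
    simp only [Complex.real_smul, Pi.sub_apply, mul_comm (g _ : ℂ), sub_mul]
    rw [integral_sub (hint h.locInt_deriv) (hint h'.locInt_deriv), heq, sub_self]
  rw [Filter.EventuallyEq, ae_restrict_iff' hΩ.measurableSet]
  filter_upwards [hΩ.ae_eq_zero_of_integral_contDiff_smul_eq_zero
    (h.locInt_deriv.sub h'.locInt_deriv) hzero] with p hp hpΩ using sub_eq_zero.1 (hp hpΩ)

end WeakDerivative

section FormDomain

variable {Ω Γ : Set (ℝ × ℝ)} {g : ℝ × ℝ → ℝ} {u ux uy vx vy f : ℝ × ℝ → ℂ}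

theorem hasWeakGradient_iff : HasWeakGradient Ω u ux uy ↔
    HasWeakDirDeriv volume Ω (1, 0) u ux ∧ HasWeakDirDeriv volume Ω (0, 1) u uy :=
  ⟨fun h => ⟨⟨h.locInt, h.locInt_x, h.weak_x⟩, ⟨h.locInt, h.locInt_y, h.weak_y⟩⟩,
    fun h => ⟨h.1.locInt, h.1.locInt_deriv, h.2.locInt_deriv, h.1.weak, h.2.weak⟩⟩

/-- The real functions that multiply form domains into themselves: smooth, bounded, and with
bounded derivative. -/
structure IsBoundedMultiplier (g : ℝ × ℝ → ℝ) : Prop where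
  contDiff : ContDiff ℝ ∞ g
  bounded : ∃ C, ∀ p, ‖g p‖ ≤ C
  bounded_fderiv : ∃ C, ∀ p, ‖fderiv ℝ g p‖ ≤ C

theorem IsBoundedMultiplier.exists_norm_fderiv_apply_le (hg : IsBoundedMultiplier g) (v : ℝ × ℝ) :
    ∃ C, ∀ p, ‖fderiv ℝ g p v‖ ≤ C :=
  let ⟨C, hC⟩ := hg.bounded_fderiv
  ⟨C * ‖v‖, fun p => (fderiv ℝ g p).le_of_opNorm_le (hC p) v⟩

theorem IsBoundedMultiplier.memLp_smul {μ : Measure (ℝ × ℝ)} (hg : IsBoundedMultiplier g)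
    (hu : MemLp u 2 μ) : MemLp (g • u) 2 μ :=
  let ⟨_, hC⟩ := hg.bounded
  memLp_smul_of_bound hg.contDiff.continuous.aestronglyMeasurable hC hu

theorem IsBoundedMultiplier.memLp_productDeriv {μ : Measure (ℝ × ℝ)} (hg : IsBoundedMultiplier g)
    (v : ℝ × ℝ) (hu : MemLp u 2 μ) (hux : MemLp ux 2 μ) : MemLp (productDeriv v g u ux) 2 μ :=
  let ⟨_, hC⟩ := hg.exists_norm_fderiv_apply_le v
  (hg.memLp_smul hux).add (memLp_smul_of_bound
    (continuous_fderiv_apply hg.contDiff v).aestronglyMeasurable hC hu)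

theorem IsBoundedMultiplier.tendsto_eLpNorm_productDeriv {μ : Measure (ℝ × ℝ)}
    {z z' : ℕ → ℝ × ℝ → ℂ} (hg : IsBoundedMultiplier g) (v : ℝ × ℝ)
    (hz_meas : ∀ n, AEStronglyMeasurable (z n) μ) (hz'_meas : ∀ n, AEStronglyMeasurable (z' n) μ)
    (hz : Tendsto (fun n => eLpNorm (z n) 2 μ) atTop (𝓝 0))
    (hz' : Tendsto (fun n => eLpNorm (z' n) 2 μ) atTop (𝓝 0)) :
    Tendsto (fun n => eLpNorm (productDeriv v g (z n) (z' n)) 2 μ) atTop (𝓝 0) := by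
  obtain ⟨C, hC⟩ := hg.bounded
  obtain ⟨C', hC'⟩ := hg.exists_norm_fderiv_apply_le v
  have h := (tendsto_eLpNorm_smul_of_bound hC hz').add (tendsto_eLpNorm_smul_of_bound hC' hz)
  rw [add_zero] at h
  refine tendsto_of_tendsto_of_tendsto_of_le_of_le tendsto_const_nhds h (fun _ => zero_le)
    fun n => ?_
  exact eLpNorm_add_le (hg.contDiff.continuous.aestronglyMeasurable.smul (hz'_meas n))
    ((continuous_fderiv_apply hg.contDiff v).aestronglyMeasurable.smul (hz_meas n)) (by norm_num)

theorem MemH1.smul (hΩ : IsOpen Ω) (hg : IsBoundedMultiplier g) (h : MemH1 Ω u ux uy) :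
    MemH1 Ω (g • u) (productDeriv (1, 0) g u ux) (productDeriv (0, 1) g u uy) where
  memLp := hg.memLp_smul h.memLp
  memLp_x := hg.memLp_productDeriv _ h.memLp h.memLp_x
  memLp_y := hg.memLp_productDeriv _ h.memLp h.memLp_y
  weakGradient :=
    have hu := hasWeakGradient_iff.1 h.weakGradient
    hasWeakGradient_iff.2 ⟨hu.1.smul hΩ hg.contDiff, hu.2.smul hΩ hg.contDiff⟩

theorem MemFormDomain.smul (hΩ : IsOpen Ω) (hg : IsBoundedMultiplier g)
    (h : MemFormDomain Ω Γ u ux uy) :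
    MemFormDomain Ω Γ (g • u) (productDeriv (1, 0) g u ux) (productDeriv (0, 1) g u uy) := by
  obtain ⟨φ, hφ, h0, hx, hy⟩ := h.approx
  obtain ⟨C, hC⟩ := hg.bounded
  have hsub_meas (n : ℕ) : AEStronglyMeasurable (u - φ n) (volume.restrict Ω) :=
    h.memH1.memLp.1.sub (hφ n).1.continuous.aestronglyMeasurable
  have tendsto_deriv {u' : ℝ × ℝ → ℂ} (v : ℝ × ℝ) (hu' : MemLp u' 2 (volume.restrict Ω))
      (hlim : Tendsto (fun n => eLpNorm (u' - fun p => fderiv ℝ (φ n) p v) 2 (volume.restrict Ω))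
        atTop (𝓝 0)) :
      Tendsto (fun n => eLpNorm (productDeriv v g u u' - fun p => fderiv ℝ (g • φ n) p v) 2
        (volume.restrict Ω)) atTop (𝓝 0) :=
    (hg.tendsto_eLpNorm_productDeriv v hsub_meas (fun n => hu'.1.sub
      (continuous_fderiv_apply (hφ n).1 v).aestronglyMeasurable) h0 hlim).congr fun n => by
        rw [productDeriv_sub, fderiv_smul_apply_eq_productDeriv
          (hg.contDiff.differentiable (by simp)) ((hφ n).1.differentiable (by simp))]
  refine ⟨h.memH1.smul hΩ hg, fun n => g • φ n, fun n => ⟨hg.contDiff.smul (hφ n).1,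
    (hφ n).2.1.smul_left, (tsupport_smul_subset_right g (φ n)).trans (hφ n).2.2⟩, ?_,
    tendsto_deriv (1, 0) h.memH1.memLp_x hx, tendsto_deriv (0, 1) h.memH1.memLp_y hy⟩
  exact (tendsto_eLpNorm_smul_of_bound hC h0).congr fun n => by rw [← smul_sub]; rfl

theorem HasWeakGradient.ae_eq (hΩ : IsOpen Ω) (h : HasWeakGradient Ω u ux uy)
    (h' : HasWeakGradient Ω u vx vy) :
    ux =ᵐ[volume.restrict Ω] vx ∧ uy =ᵐ[volume.restrict Ω] vy :=
  ⟨(hasWeakGradient_iff.1 h).1.ae_eq hΩ (hasWeakGradient_iff.1 h').1,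
    (hasWeakGradient_iff.1 h).2.ae_eq hΩ (hasWeakGradient_iff.1 h').2⟩

theorem MemFormDomain.congr_gradient (hΩ : IsOpen Ω) (h : MemFormDomain Ω Γ u vx vy)
    (hgrad : HasWeakGradient Ω u ux uy) : MemFormDomain Ω Γ u ux uy := by
  obtain ⟨hx, hy⟩ := h.memH1.weakGradient.ae_eq hΩ hgrad
  obtain ⟨φ, hφ, h0, hφx, hφy⟩ := h.approx
  refine ⟨⟨h.memH1.memLp, h.memH1.memLp_x.ae_eq hx, h.memH1.memLp_y.ae_eq hy, hgrad⟩, φ, hφ, h0,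
    hφx.congr fun n => eLpNorm_congr_ae (hx.sub .rfl),
    hφy.congr fun n => eLpNorm_congr_ae (hy.sub .rfl)⟩

theorem IsMixedLaplacian.memFormDomain (hΩ : IsOpen Ω) (h : IsMixedLaplacian Ω Γ u f)
    (hgrad : HasWeakGradient Ω u ux uy) : MemFormDomain Ω Γ u ux uy :=
  let ⟨_, _, hu, _⟩ := h
  hu.congr_gradient hΩ hgrad

theorem IsMixedLaplacian.integral_gradient_mul_star_eq {v vx vy : ℝ × ℝ → ℂ} (hΩ : IsOpen Ω)
    (h : IsMixedLaplacian Ω Γ u f) (hgrad : HasWeakGradient Ω u ux uy)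
    (hv : MemFormDomain Ω Γ v vx vy) :
    ∫ p in Ω, (ux p * star (vx p) + uy p * star (vy p)) = ∫ p in Ω, f p * star (v p) := by
  obtain ⟨gx, gy, hu, _, hweak⟩ := h
  obtain ⟨hx, hy⟩ := hu.memH1.weakGradient.ae_eq hΩ hgrad
  rw [← hweak v vx vy hv]
  refine integral_congr_ae ?_
  filter_upwards [hx, hy] with p hpx hpy
  rw [hpx, hpy]

/-- The squared Euclidean length of the gradient of `w`; the operator norm of `fderiv ℝ w p` is
taken with respect to the sup norm of `ℝ × ℝ`, hence is not that length. -/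
noncomputable def gradSq (w : ℝ × ℝ → ℝ) (p : ℝ × ℝ) : ℝ :=
  fderiv ℝ w p (1, 0) ^ 2 + fderiv ℝ w p (0, 1) ^ 2

theorem re_mul_star_productDeriv_smul (w : ℝ × ℝ → ℝ) (v p : ℝ × ℝ) :
    (ux p * star (productDeriv v w (w • u) (productDeriv v w u ux) p)).re =
      ‖productDeriv v w u ux p‖ ^ 2 - fderiv ℝ w p v ^ 2 * ‖u p‖ ^ 2 := by
  simp only [productDeriv, Pi.smul_apply', Complex.sq_norm, Complex.normSq_apply, Complex.real_smul,
    Complex.star_def, Complex.mul_re, Complex.mul_im, Complex.add_re, Complex.add_im,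
    Complex.conj_re, Complex.conj_im, Complex.ofReal_re, Complex.ofReal_im]
  ring

variable {w : ℝ × ℝ → ℝ}

theorem MemH1.integrable_norm_sq_gradient (h : MemH1 Ω u ux uy) :
    IntegrableOn (fun p => ‖ux p‖ ^ 2 + ‖uy p‖ ^ 2) Ω :=
  (h.memLp_x.integrable_norm_pow two_ne_zero).add (h.memLp_y.integrable_norm_pow two_ne_zero)

/-- This is the IMS localization formula. -/
theorem IsMixedLaplacian.integral_norm_sq_productDeriv (hΩ : IsOpen Ω)
    (h : IsMixedLaplacian Ω Γ u f) (hgrad : HasWeakGradient Ω u ux uy)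
    (hw : IsBoundedMultiplier w) :
    ∫ p in Ω, (‖productDeriv (1, 0) w u ux p‖ ^ 2 + ‖productDeriv (0, 1) w u uy p‖ ^ 2) =
      (∫ p in Ω, f p * star ((w • w • u) p)).re + ∫ p in Ω, gradSq w p * ‖u p‖ ^ 2 := by
  have hu := h.memFormDomain hΩ hgrad
  have hwu := hu.smul hΩ hw
  have hwwu := hwu.smul hΩ hw
  have hpair_int : IntegrableOn (fun p => ux p * star (productDeriv (1, 0) w (w • u)
      (productDeriv (1, 0) w u ux) p) + uy p * star (productDeriv (0, 1) w (w • u)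
      (productDeriv (0, 1) w u uy) p)) Ω :=
    (hu.memH1.memLp_x.integrable_mul hwwu.memH1.memLp_x.star).add
      (hu.memH1.memLp_y.integrable_mul hwwu.memH1.memLp_y.star)
  have henergy_int := hwu.memH1.integrable_norm_sq_gradient
  have hre (p : ℝ × ℝ) : (ux p * star (productDeriv (1, 0) w (w • u)
      (productDeriv (1, 0) w u ux) p) + uy p * star (productDeriv (0, 1) w (w • u)
      (productDeriv (0, 1) w u uy) p)).re =
      ‖productDeriv (1, 0) w u ux p‖ ^ 2 + ‖productDeriv (0, 1) w u uy p‖ ^ 2 -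
        gradSq w p * ‖u p‖ ^ 2 := by
    rw [Complex.add_re, re_mul_star_productDeriv_smul, re_mul_star_productDeriv_smul, gradSq]
    ring
  have hgradSq_int : IntegrableOn (fun p => gradSq w p * ‖u p‖ ^ 2) Ω :=
    (henergy_int.sub hpair_int.re).congr (.of_forall fun p => by
      simp only [Pi.sub_apply, RCLike.re_eq_complex_re, hre, sub_sub_cancel])
  rw [← h.integral_gradient_mul_star_eq hΩ hgrad hwwu, ← RCLike.re_eq_complex_re,
    ← integral_re hpair_int]
  simp only [RCLike.re_eq_complex_re, hre]
  rw [integral_sub henergy_int hgradSq_int, sub_add_cancel]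

/-- A multiplier `w` with `|∇w| ≤ a |w|`: the weights admitted in Agmon's method, of which
`exp (a x)` would be the model if it were bounded. -/
structure IsAgmonWeight (a : ℝ) (w : ℝ × ℝ → ℝ) : Prop extends IsBoundedMultiplier w where
  gradSq_le : ∀ p, gradSq w p ≤ a ^ 2 * w p ^ 2

/-- Functions of the form domain carry at least `κ` times their mass on `S` as Dirichlet energy on
`S`.  When `Ω ∖ S` is bounded, this keeps the essential spectrum of the mixed Laplacian above `κ`
(Persson). -/
def HasGapOn (Ω Γ S : Set (ℝ × ℝ)) (κ : ℝ) : Prop :=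
  ∀ v vx vy : ℝ × ℝ → ℂ, MemFormDomain Ω Γ v vx vy →
    κ * ∫ p in S, ‖v p‖ ^ 2 ≤ ∫ p in S, (‖vx p‖ ^ 2 + ‖vy p‖ ^ 2)

variable {a κ lam K : ℝ} {S : Set (ℝ × ℝ)}

theorem IsAgmonWeight.energy_le (hΩ : IsOpen Ω)
    (h : IsMixedLaplacian Ω Γ u fun p => (lam : ℂ) * u p) (hgrad : HasWeakGradient Ω u ux uy)
    (hw : IsAgmonWeight a w) :
    ∫ p in Ω, (‖productDeriv (1, 0) w u ux p‖ ^ 2 + ‖productDeriv (0, 1) w u uy p‖ ^ 2) ≤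
      (lam + a ^ 2) * ∫ p in Ω, ‖(w • u) p‖ ^ 2 := by
  have hmass_int : IntegrableOn (fun p => ‖(w • u) p‖ ^ 2) Ω :=
    (hw.memLp_smul (h.memFormDomain hΩ hgrad).memH1.memLp).integrable_norm_pow two_ne_zero
  have hpotential : ∫ p in Ω, lam * u p * star ((w • w • u) p) =
      ((lam * ∫ p in Ω, ‖(w • u) p‖ ^ 2 : ℝ) : ℂ) := by
    rw [← integral_const_mul, ← integral_complex_ofReal]
    congr 1 with p
    simp only [Pi.smul_apply', Complex.real_smul, Complex.star_def, map_mul,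
      Complex.conj_ofReal, Complex.ofReal_mul, Complex.ofReal_pow, ← Complex.mul_conj']
    ring
  have hgradSq : ∫ p in Ω, gradSq w p * ‖u p‖ ^ 2 ≤ a ^ 2 * ∫ p in Ω, ‖(w • u) p‖ ^ 2 := by
    rw [← integral_const_mul]
    refine integral_mono_of_nonneg (.of_forall fun p => ?_) (hmass_int.const_mul _)
      (.of_forall fun p => ?_)
    · unfold gradSq; positivity
    · simp only [norm_smul_apply_sq, ← mul_assoc]
      exact mul_le_mul_of_nonneg_right (hw.gradSq_le p) (sq_nonneg _)
  rw [h.integral_norm_sq_productDeriv hΩ hgrad hw.toIsBoundedMultiplier, hpotential,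
    Complex.ofReal_re, add_mul]
  gcongr

theorem IsAgmonWeight.mass_le (hΩ : IsOpen Ω) (hS : MeasurableSet S) (hSΩ : S ⊆ Ω)
    (hgap : HasGapOn Ω Γ S κ) (hκ : lam + a ^ 2 < κ)
    (h : IsMixedLaplacian Ω Γ u fun p => (lam : ℂ) * u p) (hgrad : HasWeakGradient Ω u ux uy)
    (hw : IsAgmonWeight a w) (hK : ∀ p ∈ Ω \ S, |w p| ≤ K) :
    ∫ p in Ω, ‖(w • u) p‖ ^ 2 ≤
      |κ| * K ^ 2 / (κ - (lam + a ^ 2)) * ∫ p in Ω, ‖u p‖ ^ 2 := by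
  have hu := h.memFormDomain hΩ hgrad
  have hwu := hu.smul hΩ hw.toIsBoundedMultiplier
  have hmass_int : IntegrableOn (fun p => ‖(w • u) p‖ ^ 2) Ω :=
    hwu.memH1.memLp.integrable_norm_pow two_ne_zero
  have hu_int : IntegrableOn (fun p => ‖u p‖ ^ 2) Ω :=
    hu.memH1.memLp.integrable_norm_pow two_ne_zero
  have hsplit : ∫ p in Ω, ‖(w • u) p‖ ^ 2 =
      (∫ p in S, ‖(w • u) p‖ ^ 2) + ∫ p in Ω \ S, ‖(w • u) p‖ ^ 2 := by
    rw [setIntegral_sdiff hS hmass_int hSΩ]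
    ring
  have houtside : ∫ p in Ω \ S, ‖(w • u) p‖ ^ 2 ≤ K ^ 2 * ∫ p in Ω, ‖u p‖ ^ 2 :=
    setIntegral_norm_smul_sq_le (hΩ.measurableSet.diff hS) sdiff_subset hu_int hK
  have hinside : κ * ∫ p in S, ‖(w • u) p‖ ^ 2 ≤
      (lam + a ^ 2) * ∫ p in Ω, ‖(w • u) p‖ ^ 2 :=
    (hgap _ _ _ hwu).trans <| (setIntegral_mono_set hwu.memH1.integrable_norm_sq_gradient
      (.of_forall fun p => by positivity) hSΩ.eventuallyLE).trans (hw.energy_le hΩ h hgrad)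
  have houtside_nonneg : 0 ≤ ∫ p in Ω \ S, ‖(w • u) p‖ ^ 2 :=
    integral_nonneg fun p => sq_nonneg _
  rw [div_mul_eq_mul_div, le_div_iff₀ (sub_pos.2 hκ)]
  calc (∫ p in Ω, ‖(w • u) p‖ ^ 2) * (κ - (lam + a ^ 2))
      ≤ κ * ∫ p in Ω \ S, ‖(w • u) p‖ ^ 2 := by rw [hsplit] at hinside ⊢; linarith
    _ ≤ |κ| * ∫ p in Ω \ S, ‖(w • u) p‖ ^ 2 := by gcongr; exact le_abs_self κ
    _ ≤ |κ| * (K ^ 2 * ∫ p in Ω, ‖u p‖ ^ 2) := by gcongr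
    _ = |κ| * K ^ 2 * ∫ p in Ω, ‖u p‖ ^ 2 := (mul_assoc _ _ _).symm

theorem norm_smul_sq_le_norm_productDeriv_sq (w : ℝ × ℝ → ℝ) (v p : ℝ × ℝ) :
    w p ^ 2 * ‖ux p‖ ^ 2 ≤
      2 * ‖productDeriv v w u ux p‖ ^ 2 + 2 * (fderiv ℝ w p v ^ 2 * ‖u p‖ ^ 2) := by
  have hsub := norm_sub_le (productDeriv v w u ux p) (fderiv ℝ w p v • u p)
  rw [productDeriv, add_sub_cancel_right] at hsub
  calc w p ^ 2 * ‖ux p‖ ^ 2 = ‖w p • ux p‖ ^ 2 := (norm_smul_apply_sq w ux p).symm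
    _ ≤ (‖productDeriv v w u ux p‖ + ‖fderiv ℝ w p v • u p‖) ^ 2 := by gcongr; exact hsub
    _ ≤ 2 * (‖productDeriv v w u ux p‖ ^ 2 + ‖fderiv ℝ w p v • u p‖ ^ 2) := add_sq_le
    _ = _ := by rw [norm_smul, mul_pow, Real.norm_eq_abs, sq_abs, mul_add]

theorem IsAgmonWeight.weighted_norm_sq_le (hw : IsAgmonWeight a w) (p : ℝ × ℝ) :
    w p ^ 2 * (‖u p‖ ^ 2 + (‖ux p‖ ^ 2 + ‖uy p‖ ^ 2)) ≤ (1 + 2 * a ^ 2) * ‖(w • u) p‖ ^ 2 +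
      2 * (‖productDeriv (1, 0) w u ux p‖ ^ 2 + ‖productDeriv (0, 1) w u uy p‖ ^ 2) := by
  have hx := norm_smul_sq_le_norm_productDeriv_sq (u := u) (ux := ux) w (1, 0) p
  have hy := norm_smul_sq_le_norm_productDeriv_sq (u := u) (ux := uy) w (0, 1) p
  have hgradSq := mul_le_mul_of_nonneg_right (hw.gradSq_le p) (sq_nonneg ‖u p‖)
  rw [gradSq] at hgradSq
  rw [norm_smul_apply_sq]
  linarith

theorem MemH1.integrable_weighted_norm_sq (h : MemH1 Ω u ux uy) (hw : IsBoundedMultiplier w) :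
    IntegrableOn (fun p => w p ^ 2 * (‖u p‖ ^ 2 + (‖ux p‖ ^ 2 + ‖uy p‖ ^ 2))) Ω := by
  have hint {f : ℝ × ℝ → ℂ} (hf : MemLp f 2 (volume.restrict Ω)) :
      IntegrableOn (fun p => w p ^ 2 * ‖f p‖ ^ 2) Ω := by
    simpa only [IntegrableOn, norm_smul_apply_sq] using
      (hw.memLp_smul hf).integrable_norm_pow two_ne_zero
  simp only [mul_add]
  exact (hint h.memLp).add ((hint h.memLp_x).add (hint h.memLp_y))

theorem IsMixedLaplacian.exists_forall_agmonWeight_integral_le (hΩ : IsOpen Ω)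
    (hS : MeasurableSet S) (hSΩ : S ⊆ Ω) (hgap : HasGapOn Ω Γ S κ) (hκ : lam + a ^ 2 < κ)
    (h : IsMixedLaplacian Ω Γ u fun p => (lam : ℂ) * u p) (hgrad : HasWeakGradient Ω u ux uy)
    (K : ℝ) : ∃ C, ∀ w : ℝ × ℝ → ℝ, IsAgmonWeight a w → (∀ p ∈ Ω \ S, |w p| ≤ K) →
      ∫ p in Ω, w p ^ 2 * (‖u p‖ ^ 2 + (‖ux p‖ ^ 2 + ‖uy p‖ ^ 2)) ≤ C := by
  refine ⟨|1 + 2 * a ^ 2 + 2 * (lam + a ^ 2)| *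
    (|κ| * K ^ 2 / (κ - (lam + a ^ 2)) * ∫ p in Ω, ‖u p‖ ^ 2), fun w hw hK => ?_⟩
  have hu := (h.memFormDomain hΩ hgrad).memH1
  have hwu := hu.smul hΩ hw.toIsBoundedMultiplier
  have hmass_int := (hwu.memLp.integrable_norm_pow two_ne_zero).const_mul (1 + 2 * a ^ 2)
  have henergy_int := hwu.integrable_norm_sq_gradient.const_mul 2
  calc ∫ p in Ω, w p ^ 2 * (‖u p‖ ^ 2 + (‖ux p‖ ^ 2 + ‖uy p‖ ^ 2))
      ≤ ∫ p in Ω, ((1 + 2 * a ^ 2) * ‖(w • u) p‖ ^ 2 +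
          2 * (‖productDeriv (1, 0) w u ux p‖ ^ 2 + ‖productDeriv (0, 1) w u uy p‖ ^ 2)) :=
        integral_mono (hu.integrable_weighted_norm_sq hw.toIsBoundedMultiplier)
          (hmass_int.add henergy_int) fun p => hw.weighted_norm_sq_le p
    _ = (1 + 2 * a ^ 2) * (∫ p in Ω, ‖(w • u) p‖ ^ 2) + 2 * ∫ p in Ω,
          (‖productDeriv (1, 0) w u ux p‖ ^ 2 + ‖productDeriv (0, 1) w u uy p‖ ^ 2) := by
        rw [integral_add hmass_int henergy_int, integral_const_mul, integral_const_mul]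
    _ ≤ (1 + 2 * a ^ 2 + 2 * (lam + a ^ 2)) * ∫ p in Ω, ‖(w • u) p‖ ^ 2 := by
        linarith [hw.energy_le hΩ h hgrad]
    _ ≤ |1 + 2 * a ^ 2 + 2 * (lam + a ^ 2)| * ∫ p in Ω, ‖(w • u) p‖ ^ 2 :=
        mul_le_mul_of_nonneg_right (le_abs_self _) (integral_nonneg fun p => sq_nonneg _)
    _ ≤ _ := mul_le_mul_of_nonneg_left (hw.mass_le hΩ hS hSΩ hgap hκ h hgrad hK) (abs_nonneg _)

theorem IsMixedLaplacian.integrableOn_of_tendsto_agmonWeight {w : ℕ → ℝ × ℝ → ℝ} {W : ℝ × ℝ → ℝ}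
    (hΩ : IsOpen Ω) (hS : MeasurableSet S) (hSΩ : S ⊆ Ω) (hgap : HasGapOn Ω Γ S κ)
    (hκ : lam + a ^ 2 < κ) (h : IsMixedLaplacian Ω Γ u fun p => (lam : ℂ) * u p)
    (hgrad : HasWeakGradient Ω u ux uy) (hw : ∀ n, IsAgmonWeight a (w n))
    (hK : ∀ n, ∀ p ∈ Ω \ S, |w n p| ≤ K) (hW : ∀ p, Tendsto (w · p) atTop (𝓝 (W p))) :
    IntegrableOn (fun p => W p ^ 2 * (‖u p‖ ^ 2 + (‖ux p‖ ^ 2 + ‖uy p‖ ^ 2))) Ω := by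
  obtain ⟨C, hC⟩ := h.exists_forall_agmonWeight_integral_le hΩ hS hSΩ hgap hκ hgrad K
  refine integrable_of_tendsto_of_integral_norm_le (C := C) (fun n =>
    (h.memFormDomain hΩ hgrad).memH1.integrable_weighted_norm_sq (hw n).toIsBoundedMultiplier)
    (fun n => ?_) (.of_forall fun p => ((hW p).pow 2).mul_const _)
  rw [integral_congr_ae (.of_forall fun p => Real.norm_of_nonneg (by positivity))]
  exact hC (w n) (hw n) (hK n)

end FormDomain

section ExponentialWeight

variable {a δ : ℝ}

/-- The bounded smooth substitute `exp (a x) / (1 + δ exp (a x))` for the weight `exp (a x)`. -/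
noncomputable def regExp (a δ x : ℝ) : ℝ := (Real.exp (-(a * x)) + δ)⁻¹

theorem regExp_pos (hδ : 0 < δ) (x : ℝ) : 0 < regExp a δ x :=
  inv_pos.2 (add_pos (Real.exp_pos _) hδ)

theorem regExp_le_inv (hδ : 0 < δ) (x : ℝ) : regExp a δ x ≤ δ⁻¹ :=
  inv_anti₀ hδ (le_add_of_nonneg_left (Real.exp_pos _).le)

theorem regExp_le_exp (hδ : 0 < δ) (x : ℝ) : regExp a δ x ≤ Real.exp (a * x) := by
  rw [← inv_inv (Real.exp (a * x)), ← Real.exp_neg]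
  exact inv_anti₀ (Real.exp_pos _) (le_add_of_nonneg_right hδ.le)

theorem contDiff_regExp (hδ : 0 < δ) : ContDiff ℝ ∞ (regExp a δ) :=
  ContDiff.inv (by fun_prop) fun x => (add_pos (Real.exp_pos _) hδ).ne'

theorem hasDerivAt_regExp (hδ : 0 < δ) (x : ℝ) :
    HasDerivAt (regExp a δ) (a * (Real.exp (-(a * x)) * regExp a δ x) * regExp a δ x) x := by
  have hexp : HasDerivAt (fun y => Real.exp (-(a * y)) + δ) (Real.exp (-(a * x)) * -a) x := by
    simpa using (((hasDerivAt_id x).const_mul a).neg.exp).add_const δ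
  refine (hexp.inv (add_pos (Real.exp_pos _) hδ).ne').congr_deriv ?_
  rw [regExp, div_eq_mul_inv, ← inv_pow]
  ring

theorem abs_deriv_regExp_le (hδ : 0 < δ) (x : ℝ) :
    |deriv (regExp a δ) x| ≤ |a| * regExp a δ x := by
  have hle : Real.exp (-(a * x)) * regExp a δ x ≤ 1 :=
    mul_inv_le_one_of_le₀ (le_add_of_nonneg_right hδ.le) (add_pos (Real.exp_pos _) hδ).le
  have hpos := regExp_pos (a := a) hδ x
  rw [(hasDerivAt_regExp hδ x).deriv, abs_mul, abs_mul, abs_of_pos hpos,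
    abs_of_pos (mul_pos (Real.exp_pos _) hpos)]
  gcongr
  exact mul_le_of_le_one_right (abs_nonneg a) hle

theorem tendsto_regExp (x : ℝ) :
    Tendsto (fun n : ℕ => regExp a (1 / ((n : ℝ) + 1)) x) atTop (𝓝 (Real.exp (a * x))) := by
  have h := (tendsto_one_div_add_atTop_nhds_zero_nat (𝕜 := ℝ)).const_add (Real.exp (-(a * x)))
  rw [add_zero] at h
  simpa only [regExp, ← Real.exp_neg, neg_neg] using h.inv₀ (Real.exp_pos _).ne'

theorem fderiv_comp_fst_apply {g : ℝ → ℝ} (hg : Differentiable ℝ g) (p v : ℝ × ℝ) :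
    fderiv ℝ (fun q : ℝ × ℝ => g q.1) p v = v.1 * deriv g p.1 := by
  have h : HasFDerivAt (fun q : ℝ × ℝ => g q.1) _ p :=
    (hg p.1).hasDerivAt.hasFDerivAt.comp p hasFDerivAt_fst
  rw [h.fderiv]
  simp

theorem isAgmonWeight_regExp_comp_fst (hδ : 0 < δ) :
    IsAgmonWeight a fun p => regExp a δ p.1 where
  contDiff := (contDiff_regExp hδ).comp contDiff_fst
  bounded := ⟨δ⁻¹, fun p => by
    rw [Real.norm_of_nonneg (regExp_pos hδ _).le]
    exact regExp_le_inv hδ _⟩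
  bounded_fderiv := by
    refine ⟨|a| * δ⁻¹, fun p => ContinuousLinearMap.opNorm_le_bound _ (by positivity) fun v => ?_⟩
    rw [fderiv_comp_fst_apply ((contDiff_regExp hδ).differentiable (by simp)), norm_mul, mul_comm]
    gcongr
    · exact (abs_deriv_regExp_le hδ p.1).trans (by gcongr; exact regExp_le_inv hδ _)
    · exact norm_fst_le v
  gradSq_le p := by
    have h := pow_le_pow_left₀ (abs_nonneg _) (abs_deriv_regExp_le (a := a) hδ p.1) 2
    rw [sq_abs, mul_pow, sq_abs] at h
    simpa [gradSq, fderiv_comp_fst_apply ((contDiff_regExp hδ).differentiable (by simp))] using h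

end ExponentialWeight

section ExponentialDecay

variable {Ω Γ : Set (ℝ × ℝ)} {ψ ψx ψy : ℝ × ℝ → ℂ} {R κ lam a : ℝ}

theorem IsMixedLaplacian.integrableOn_exp_sq_mul (hΩ : IsOpen Ω)
    (hgap : HasGapOn Ω Γ (Ω ∩ {p | R < p.1}) κ) (ha : 0 ≤ a) (haκ : lam + a ^ 2 < κ)
    (hψ : IsMixedLaplacian Ω Γ ψ fun p => (lam : ℂ) * ψ p) (hgrad : HasWeakGradient Ω ψ ψx ψy) :
    IntegrableOn (fun p => Real.exp (a * p.1) ^ 2 * (‖ψ p‖ ^ 2 + (‖ψx p‖ ^ 2 + ‖ψy p‖ ^ 2))) Ω := by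
  have hS : MeasurableSet (Ω ∩ {p | R < p.1}) :=
    hΩ.measurableSet.inter (measurableSet_lt measurable_const measurable_fst)
  refine hψ.integrableOn_of_tendsto_agmonWeight (K := Real.exp (a * R)) hΩ hS inter_subset_left
    hgap haκ hgrad (fun n => isAgmonWeight_regExp_comp_fst Nat.one_div_pos_of_nat)
    (fun n p hp => ?_) fun p => tendsto_regExp p.1
  have hpR : p.1 ≤ R := not_lt.1 fun h => hp.2 ⟨hp.1, h⟩
  rw [abs_of_pos (regExp_pos Nat.one_div_pos_of_nat _)]
  exact (regExp_le_exp Nat.one_div_pos_of_nat _).trans (by gcongr)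

theorem proposition6p1_general (hΩ : IsOpen Ω) (hgap : HasGapOn Ω Γ (Ω ∩ {p | R < p.1}) κ)
    (hlam : lam < κ) (hψ : IsMixedLaplacian Ω Γ ψ fun p => (lam : ℂ) * ψ p)
    (hgrad : HasWeakGradient Ω ψ ψx ψy) {ε : ℝ} (hε : 0 < ε) :
    IntegrableOn (fun p => Real.exp (2 * p.1 * (Real.sqrt (κ - lam) - ε)) *
      (‖ψ p‖ ^ 2 + (‖ψx p‖ ^ 2 + ‖ψy p‖ ^ 2))) (Ω ∩ {p | R < p.1}) := by
  set b := Real.sqrt (κ - lam) - ε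
  -- Agmon's method yields a rate `a ≥ 0`; when `b < 0`, the weight is bounded on `x > R`.
  let a := max b 0
  have ha : 0 ≤ a := le_max_right b 0
  have haκ : lam + a ^ 2 < κ := by
    have hlt : a < Real.sqrt (κ - lam) :=
      max_lt (sub_lt_self _ hε) (Real.sqrt_pos.2 (sub_pos.2 hlam))
    linarith [(Real.lt_sqrt ha).1 hlt]
  have hbound : ∀ᵐ p : ℝ × ℝ ∂volume.restrict (Ω ∩ {p | R < p.1}),
      ‖Real.exp (2 * p.1 * (b - a))‖ ≤ Real.exp (2 * R * (b - a)) := by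
    refine ae_restrict_of_forall_mem (hΩ.measurableSet.inter
      (measurableSet_lt measurable_const measurable_fst)) fun p hp => ?_
    rw [Real.norm_of_nonneg (Real.exp_pos _).le, Real.exp_le_exp]
    exact mul_le_mul_of_nonpos_right (by linarith [hp.2.out]) (sub_nonpos.2 (le_max_left b 0))
  refine (((hψ.integrableOn_exp_sq_mul hΩ hgap ha haκ hgrad).mono_set inter_subset_left).bdd_mul
    (by fun_prop) hbound).congr (.of_forall fun p => ?_)
  simp only [← mul_assoc, ← Real.exp_nat_mul, ← Real.exp_add]
  ring_nf

end ExponentialDecay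

section Strip

variable {φ : ℝ × ℝ → ℂ} {I : Set ℝ} {c d : ℝ}

theorem setIntegral_prod_mono_of_fiberwise {α β : Type*} [MeasurableSpace α] [MeasurableSpace β]
    {μ : Measure α} {ν : Measure β} [SFinite μ] [SFinite ν] {F G : α × β → ℝ} {s : Set α}
    {t : Set β} (hs : MeasurableSet s) (hF : IntegrableOn F (s ×ˢ t) (μ.prod ν))
    (hG : IntegrableOn G (s ×ˢ t) (μ.prod ν))
    (h : ∀ x ∈ s, ∫ y in t, F (x, y) ∂ν ≤ ∫ y in t, G (x, y) ∂ν) :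
    ∫ p in s ×ˢ t, F p ∂μ.prod ν ≤ ∫ p in s ×ˢ t, G p ∂μ.prod ν := by
  rw [setIntegral_prod _ hF, setIntegral_prod _ hG]
  rw [IntegrableOn, ← Measure.prod_restrict] at hF hG
  exact setIntegral_mono_on hF.integral_prod_left hG.integral_prod_left hs h

theorem sq_pi_div_mul_setIntegral_prod_Ioo_le (hI : MeasurableSet I) (hcd : c < d)
    (hφ : ContDiff ℝ ∞ φ) (hφc : HasCompactSupport φ) (hc : ∀ x ∈ I, φ (x, c) = 0)
    (hd : ∀ x ∈ I, φ (x, d) = 0) :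
    (Real.pi / (d - c)) ^ 2 * ∫ p in I ×ˢ Ioo c d, ‖φ p‖ ^ 2 ≤
      ∫ p in I ×ˢ Ioo c d, ‖partialY φ p‖ ^ 2 := by
  have hφy : Continuous (partialY φ) := continuous_fderiv_apply hφ (0, 1)
  have hφ_int : Integrable fun p => ‖φ p‖ ^ 2 :=
    (hφ.continuous.memLp_of_hasCompactSupport hφc).integrable_norm_pow two_ne_zero
  have hφy_int : Integrable fun p => ‖partialY φ p‖ ^ 2 :=
    (hφy.memLp_of_hasCompactSupport (hφc.fderiv_apply ℝ (0, 1))).integrable_norm_pow two_ne_zero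
  have hderiv (x y : ℝ) : HasDerivAt (fun y => φ (x, y)) (partialY φ (x, y)) y :=
    (hφ.differentiable (by simp) (x, y)).hasFDerivAt.comp_hasDerivAt y
      ((hasDerivAt_const y x).prodMk (hasDerivAt_id y))
  rw [← integral_const_mul]
  refine setIntegral_prod_mono_of_fiberwise hI (hφ_int.const_mul _).integrableOn
    hφy_int.integrableOn fun x hx => ?_
  rw [integral_const_mul]
  simp only [← integral_Ioc_eq_integral_Ioo, ← intervalIntegral.integral_of_le hcd.le]
  exact sq_pi_div_mul_integral_norm_sq_le hcd (fun y _ => hderiv x y) (by fun_prop)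
    (hc x hx) (hd x hx)

theorem hasGapOn_prod_Ioo {Ω Γ : Set (ℝ × ℝ)} (hI : MeasurableSet I) (hcd : c < d)
    (hΩ : I ×ˢ Ioo c d ⊆ Ω) (hΓ : ∀ x ∈ I, (x, c) ∈ Γ ∧ (x, d) ∈ Γ) :
    HasGapOn Ω Γ (I ×ˢ Ioo c d) ((Real.pi / (d - c)) ^ 2) := fun v vx vy hv => by
  obtain ⟨φ, hφ, h0, -, hy⟩ := hv.approx
  have hμ : volume.restrict (I ×ˢ Ioo c d) ≤ (volume : Measure (ℝ × ℝ)).restrict Ω :=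
    Measure.restrict_mono hΩ le_rfl
  have tendsto_sq {z : ℝ × ℝ → ℂ} {ζ : ℕ → ℝ × ℝ → ℂ} (hz : MemLp z 2 (volume.restrict Ω))
      (hζ : ∀ n, Continuous (ζ n)) (hζc : ∀ n, HasCompactSupport (ζ n))
      (hlim : Tendsto (fun n => eLpNorm (z - ζ n) 2 (volume.restrict Ω)) atTop (𝓝 0)) :
      Tendsto (fun n => ∫ p in I ×ˢ Ioo c d, ‖ζ n p‖ ^ 2) atTop
        (𝓝 (∫ p in I ×ˢ Ioo c d, ‖z p‖ ^ 2)) :=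
    tendsto_integral_norm_sq (fun n => (hζ n).memLp_of_hasCompactSupport (hζc n))
      (hz.mono_measure hμ) (tendsto_of_tendsto_of_tendsto_of_le_of_le tendsto_const_nhds hlim
        (fun _ => zero_le) fun n => eLpNorm_mono_measure _ hμ)
  have hmass := tendsto_sq hv.memH1.memLp (fun n => (hφ n).1.continuous) (fun n => (hφ n).2.1) h0
  have henergy := tendsto_sq hv.memH1.memLp_y (fun n => continuous_fderiv_apply (hφ n).1 (0, 1))
    (fun n => (hφ n).2.1.fderiv_apply ℝ (0, 1)) hy
  have hvanish (n : ℕ) {p : ℝ × ℝ} (hp : p ∈ Γ) : φ n p = 0 :=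
    image_eq_zero_of_notMem_tsupport fun hp' => (hφ n).2.2 hp' hp
  calc (Real.pi / (d - c)) ^ 2 * ∫ p in I ×ˢ Ioo c d, ‖v p‖ ^ 2
      ≤ ∫ p in I ×ˢ Ioo c d, ‖vy p‖ ^ 2 :=
        le_of_tendsto_of_tendsto' (hmass.const_mul _) henergy fun n =>
          sq_pi_div_mul_setIntegral_prod_Ioo_le hI hcd (hφ n).1 (hφ n).2.1
            (fun x hx => hvanish n (hΓ x hx).1) (fun x hx => hvanish n (hΓ x hx).2)
    _ ≤ ∫ p in I ×ˢ Ioo c d, (‖vx p‖ ^ 2 + ‖vy p‖ ^ 2) :=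
        integral_mono ((hv.memH1.memLp_y.mono_measure hμ).integrable_norm_pow two_ne_zero)
          (hv.memH1.integrable_norm_sq_gradient.mono_set hΩ)
          fun p => le_add_of_nonneg_left (sq_nonneg _)

end Strip

section HalfGuide

variable {θ : ℝ}

theorem isOpen_halfGuide (hθ : θ ∈ Ioo 0 (Real.pi / 2)) : IsOpen (halfGuide θ) := by
  have htan := Real.tan_pos_of_pos_of_lt_pi_div_two hθ.1 hθ.2
  -- To the right of `x = 0` the slanted constraint is implied by `y < π`.
  have hslant : halfGuide θ = {p | -Real.pi / Real.tan θ < p.1 ∧ 0 < p.2 ∧ p.2 < Real.pi ∧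
      p.2 < p.1 * Real.tan θ + Real.pi} := by
    ext p
    refine ⟨fun ⟨h1, h2, h3, h4⟩ => ⟨h1, h2, h3, ?_⟩, fun ⟨h1, h2, h3, h4⟩ =>
      ⟨h1, h2, h3, fun _ => h4⟩⟩
    rcases lt_or_ge p.1 0 with h | h
    · exact h4 h
    · exact h3.trans_le (le_add_of_nonneg_left (mul_nonneg h htan.le))
  rw [hslant]
  refine IsOpen.and ?_ (IsOpen.and ?_ (IsOpen.and ?_ ?_)) <;>
    exact isOpen_lt (by fun_prop) (by fun_prop)

theorem neg_pi_div_tan_neg (hθ : θ ∈ Ioo 0 (Real.pi / 2)) : -Real.pi / Real.tan θ < 0 :=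
  div_neg_of_neg_of_pos (neg_neg_of_pos Real.pi_pos)
    (Real.tan_pos_of_pos_of_lt_pi_div_two hθ.1 hθ.2)

theorem halfGuide_inter_right (hθ : θ ∈ Ioo 0 (Real.pi / 2)) :
    halfGuide θ ∩ {p | 0 < p.1} = Ioi 0 ×ˢ Ioo 0 Real.pi := by
  ext p
  simp only [halfGuide, mem_inter_iff, mem_ofPred_eq, mem_prod, mem_Ioi, mem_Ioo]
  exact ⟨fun h => ⟨h.2, h.1.2.1, h.1.2.2.1⟩, fun h => ⟨⟨(neg_pi_div_tan_neg hθ).trans h.1, h.2.1,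
    h.2.2, fun h' => absurd h.1 h'.not_gt⟩, h.1⟩⟩

theorem hasGapOn_halfGuide_inter_right (hθ : θ ∈ Ioo 0 (Real.pi / 2)) :
    HasGapOn (halfGuide θ) (halfGuideDirichlet θ) (halfGuide θ ∩ {p | 0 < p.1}) 1 := by
  have hgap := hasGapOn_prod_Ioo (Ω := halfGuide θ) (Γ := halfGuideDirichlet θ) measurableSet_Ioi
    Real.pi_pos (halfGuide_inter_right hθ ▸ inter_subset_left)
    fun x (hx : 0 < x) => ⟨.inl ⟨rfl, ((neg_pi_div_tan_neg hθ).trans hx).le⟩, .inr ⟨rfl, hx.le⟩⟩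
  rwa [sub_zero, div_self Real.pi_ne_zero, one_pow, ← halfGuide_inter_right hθ] at hgap

end HalfGuide

theorem proposition6p1 (θ : ℝ) (hθ : θ ∈ Ioo 0 (Real.pi / 2)) (lam : ℝ) (hlam : lam < 1)
    (ψ ψx ψy : ℝ × ℝ → ℂ) (hψ : IsMixedEigenvector θ lam ψ)
    (hgrad : HasWeakGradient (halfGuide θ) ψ ψx ψy) (ε : ℝ) (hε : 0 < ε) :
    IntegrableOn
      (fun p : ℝ × ℝ => Real.exp (2 * p.1 * (Real.sqrt (1 - lam) - ε)) *
        (‖ψ p‖ ^ 2 + (‖ψx p‖ ^ 2 + ‖ψy p‖ ^ 2)))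
      (Ioi 0 ×ˢ Ioo 0 Real.pi) volume := by
  rw [← halfGuide_inter_right hθ]
  exact proposition6p1_general (isOpen_halfGuide hθ) (hasGapOn_halfGuide_inter_right hθ) hlam hψ.2
    hgrad hε
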